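/- There is a universal constant $\alpha$ with $0<\alpha\le 1$ such that the following holds. Let $G=(V,E)$ be a finite undirected graph without loops (parallel edges are allowed), let $\Delta\ge 1$ be an integer, and suppose that every vertex of $G$ has degree at most $\Delta$, where parallel edges are counted with multiplicity. Then there is a partition $V=A\cup B$, $A\cap B=\emptyset$ (with $A$ and $B$ both non-empty if $|V|\ge 2$), such that $$\mathrm{tw}(G[A])\ \ge\ \left\lfloor\frac{\alpha\,\mathrm{tw}(G)}{\Delta^2}\right\rfloor\quad\text{and}\quad \mathrm{tw}(G[B])\ \ge\ \left\lfloor\frac{\alpha\,\mathrm{tw}(G)}{\Delta^2}\right\rfloor .$$ Here $G[X]$ is the subgraph of $G$ induced by $X$, and $\mathrm{tw}$ denotes treewidth: the least integer $w\ge 0$ such that the graph has a tree decomposition all of whose bags have at most $w+1$ vertices (so the graph without vertices has treewidth $0$). -/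

import Mathlib

namespace Graph

/-- The degree of a vertex of a multigraph: parallel edges are counted with multiplicity and
loops twice. -/
noncomputable def eDegree {V E : Type*} (G : Graph V E) (v : V) : ℕ∞ :=
  (G.incidenceSet v).encard + (G.loopSet v).encard

/-- A tree decomposition of `G` whose tree has node set `ι`. -/
structure TreeDecomposition {V E : Type*} (G : Graph V E) (ι : Type*) where
  /-- The decomposition tree. -/
  tree : SimpleGraph ι
  isTree : tree.IsTree
  /-- The bags, finite sets of vertices of `G`. -/
  bag : ι → Finset V
  bag_subset : ∀ i, ∀ v ∈ bag i, v ∈ G.vertexSet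
  exists_mem_bag : ∀ v ∈ G.vertexSet, ∃ i, v ∈ bag i
  exists_adj_mem_bag : ∀ u v, G.Adj u v → ∃ i, u ∈ bag i ∧ v ∈ bag i
  /-- The nodes whose bags contain a given vertex span a subtree. -/
  connected_bags : ∀ v ∈ G.vertexSet, (tree.induce {i | v ∈ bag i}).Connected

/-- The treewidth of a finite graph: the least `w` such that `G` has a tree decomposition, over a
finite tree, whose bags all have at most `w + 1` vertices. The graph without vertices gets
treewidth `0`. -/
noncomputable def treewidth {V E : Type*} (G : Graph V E) : ℕ :=
  sInf {w : ℕ | ∃ (n : ℕ) (D : G.TreeDecomposition (Fin n)), ∀ i, (D.bag i).card ≤ w + 1}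

end Graph

/-! Suppose every partition of `U` has a side of treewidth at most `t`. Put `s = (t + 1) * Δ` and `R
= t + 54 * s`. Among partitions with both sides of treewidth at most `R`, let `(A, B)` have the
fewest crossing edges, say `m`; one side, called `A`, then has treewidth at most `t`
(`exists_minimal_partition`). Joining two sets raises treewidth by at most the number of edges
between them (`TreewidthLE.union_cross`), so large treewidth of `U` forces `m` to be large.

Bounded treewidth and degree give cheap balanced cuts. `B` splits into `B₁`, `B₂`, each receiving at
most about two thirds of the `m` edges (`TreewidthLE.exists_balanced_cut`). Iterating such cuts
divides `A` into pieces of edge boundary at most `54 * s`, with at most `m / 16` edges between any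
union of pieces and the rest of `A` (`TreewidthLE.exists_pieces`).

Start from `(B₁, A ∪ B₂)` and move pieces across one at a time until `(A ∪ B₁, B₂)`. In a suitable
order (`exists_insert_switch`) fewer than `m` edges cross at every partition that matters, so
minimality forbids both sides from having treewidth at most `R`. The first side has treewidth at
most `t` at the start but not at the end. When this fails, the other side has treewidth at most `t`,
while the first side, grown by one piece, still has treewidth at most `t + 54 * s = R`: a
contradiction. -/

namespace SimpleGraph

open Finset
open scoped Classical

variable {V ι κ : Type*}

/-! ### Tree decompositions and unions -/

/-- `bag` is a tree decomposition, over the tree `T`, of the subgraph of `H` induced by `X`. -/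
structure IsTreeDecomposition (H : SimpleGraph V) (X : Finset V) (T : SimpleGraph ι)
    (bag : ι → Finset V) : Prop where
  isTree : T.IsTree
  bag_subset : ∀ i, bag i ⊆ X
  exists_mem_bag : ∀ v ∈ X, ∃ i, v ∈ bag i
  exists_adj_mem_bag : ∀ u ∈ X, ∀ v ∈ X, H.Adj u v → ∃ i, u ∈ bag i ∧ v ∈ bag i
  connected_bags : ∀ v ∈ X, (T.induce {i | v ∈ bag i}).Connected

/-- The subgraph of `H` induced by `X` has treewidth at most `w`. -/
def TreewidthLE (H : SimpleGraph V) (X : Finset V) (w : ℕ) : Prop :=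
  ∃ (n : ℕ) (T : SimpleGraph (Fin n)) (bag : Fin n → Finset V),
    H.IsTreeDecomposition X T bag ∧ ∀ i, #(bag i) ≤ w + 1

variable {H : SimpleGraph V} {X Y : Finset V} {w : ℕ}

lemma IsTreeDecomposition.treewidthLE [Finite ι] {T : SimpleGraph ι} {bag : ι → Finset V}
    (h : H.IsTreeDecomposition X T bag) (hw : ∀ i, #(bag i) ≤ w + 1) : H.TreewidthLE X w := by
  obtain ⟨n, ⟨e⟩⟩ := Finite.exists_equiv_fin ι
  let f : T ≃g T.map e.toEmbedding := Iso.map e T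
  refine ⟨n, T.map e.toEmbedding, bag ∘ e.symm, ⟨?_, ?_, ?_, ?_, ?_⟩, fun i => hw _⟩
  · exact (Iso.isTree_iff f).1 h.isTree
  · exact fun i => h.bag_subset _
  · intro v hv
    obtain ⟨i, hi⟩ := h.exists_mem_bag v hv
    exact ⟨e i, by simpa using hi⟩
  · intro u hu v hv huv
    obtain ⟨i, hi⟩ := h.exists_adj_mem_bag u hu v hv huv
    exact ⟨e i, by simpa using hi⟩
  · intro v hv
    have hc := h.connected_bags v hv
    have : ((T.map e.toEmbedding).induce {i | v ∈ (bag ∘ e.symm) i}) ≃g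
        T.induce {i | v ∈ bag i} :=
      { toEquiv := e.symm.subtypeEquiv (fun a => by simp)
        map_rel_iff' := by
          intro a b
          simp only [comap_adj, Function.Embedding.subtype_apply, Equiv.subtypeEquiv_apply]
          constructor
          · intro hab
            simpa [f] using f.map_rel_iff.2 hab
          · intro hab
            apply f.map_rel_iff.1
            simpa [f] using hab }
    exact this.connected_iff.2 hc

lemma TreewidthLE.mono_right {w' : ℕ} (h : H.TreewidthLE X w) (hw : w ≤ w') :
    H.TreewidthLE X w' := by
  obtain ⟨n, T, bag, hT, hb⟩ := h
  exact ⟨n, T, bag, hT, fun i => (hb i).trans (by omega)⟩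

lemma TreewidthLE.subset (h : H.TreewidthLE X w) (hY : Y ⊆ X) : H.TreewidthLE Y w := by
  obtain ⟨n, T, bag, hT, hb⟩ := h
  refine ⟨n, T, fun i => bag i ∩ Y, ⟨hT.isTree, fun i => inter_subset_right, ?_, ?_, ?_⟩,
    fun i => (card_le_card inter_subset_left).trans (hb i)⟩
  · intro v hv
    obtain ⟨i, hi⟩ := hT.exists_mem_bag v (hY hv)
    exact ⟨i, mem_inter.2 ⟨hi, hv⟩⟩
  · intro u hu v hv huv
    obtain ⟨i, hi⟩ := hT.exists_adj_mem_bag u (hY hu) v (hY hv) huv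
    exact ⟨i, mem_inter.2 ⟨hi.1, hu⟩, mem_inter.2 ⟨hi.2, hv⟩⟩
  · intro v hv
    have : {i | v ∈ bag i ∩ Y} = {i | v ∈ bag i} := by
      ext i; simp [hv]
    rw [this]
    exact hT.connected_bags v (hY hv)

/-- Add `C` to every bag. -/
lemma TreewidthLE.union_card (h : H.TreewidthLE X w) (C : Finset V) :
    H.TreewidthLE (X ∪ C) (w + #C) := by
  obtain ⟨n, T, bag, hT, hb⟩ := h
  have hne : Nonempty (Fin n) := hT.isTree.connected.nonempty
  have huniv : ∀ s : Set (Fin n), s = Set.univ → (T.induce s).Connected := by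
    rintro s rfl
    exact (induceUnivIso T).connected_iff.2 hT.isTree.connected
  refine ⟨n, T, fun i => bag i ∪ C, ⟨hT.isTree, fun i => union_subset_union_left (hT.bag_subset i),
    ?_, ?_, ?_⟩, fun i => (card_union_le _ _).trans (by have := hb i; omega)⟩
  · intro v hv
    by_cases hC : v ∈ C
    · exact ⟨hne.some, mem_union_right _ hC⟩
    · obtain ⟨i, hi⟩ := hT.exists_mem_bag v (by simpa [hC] using hv)
      exact ⟨i, mem_union_left _ hi⟩
  · intro u hu v hv huv
    by_cases huC : u ∈ C <;> by_cases hvC : v ∈ C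
    · exact ⟨hne.some, by simp [huC], by simp [hvC]⟩
    · obtain ⟨i, hi⟩ := hT.exists_mem_bag v (by simpa [hvC] using hv)
      exact ⟨i, by simp [huC], by simp [hi]⟩
    · obtain ⟨i, hi⟩ := hT.exists_mem_bag u (by simpa [huC] using hu)
      exact ⟨i, by simp [hi], by simp [hvC]⟩
    · obtain ⟨i, hi⟩ := hT.exists_adj_mem_bag u (by simpa [huC] using hu) v
        (by simpa [hvC] using hv) huv
      exact ⟨i, by simp [hi.1], by simp [hi.2]⟩
  · intro v hv
    by_cases hC : v ∈ C
    · exact huniv _ (by ext i; simp [hC])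
    · have : {i | v ∈ bag i ∪ C} = {i | v ∈ bag i} := by
        ext i; simp [hC]
      rw [this]
      exact hT.connected_bags v (by simpa [hC] using hv)

lemma treewidthLE_empty (H : SimpleGraph V) (w : ℕ) : H.TreewidthLE ∅ w := by
  refine ⟨1, ⊥, fun _ => ∅, ⟨⟨?_, isAcyclic_bot⟩, by simp, by simp, by simp, by simp⟩, by simp⟩
  exact { preconnected := fun a b => by rw [Subsingleton.elim a b] }

lemma treewidthLE_card (H : SimpleGraph V) (X : Finset V) : H.TreewidthLE X #X := by
  simpa using (treewidthLE_empty H 0).union_card X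

lemma IsTree.sum_sup_edge [Finite ι] [Finite κ] {T : SimpleGraph ι} {T' : SimpleGraph κ}
    (hT : T.IsTree) (hT' : T'.IsTree) (i : ι) (j : κ) :
    ((T ⊕g T') ⊔ edge (Sum.inl i) (Sum.inr j)).IsTree := by
  classical
  have hc := (Connected.sum_sup_edge (v := i) (w := j) hT.connected hT'.connected)
  rw [isTree_iff_connected_and_card] at hT hT' ⊢
  refine ⟨hc, ?_⟩
  have h1 : Nat.card (T ⊕g T').edgeSet = Nat.card T.edgeSet + Nat.card T'.edgeSet := by
    rw [Nat.card_congr edgeSetSumEquiv, Nat.card_sum]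
  have hne : (Sum.inl i : ι ⊕ κ) ≠ Sum.inr j := by simp
  have h2 : ((T ⊕g T') ⊔ edge (Sum.inl i) (Sum.inr j)).edgeSet =
      insert s(Sum.inl i, Sum.inr j) (T ⊕g T').edgeSet := by
    rw [edgeSet_sup, edgeSet_edge_of_ne hne, Set.union_comm, Set.singleton_union]
  have h3 : s(Sum.inl i, Sum.inr j) ∉ (T ⊕g T').edgeSet := by simp
  rw [h2, Nat.card_coe_set_eq, Set.ncard_insert_of_notMem h3 (Set.toFinite _),
    ← Nat.card_coe_set_eq, h1, Nat.card_sum]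
  omega

/-- Link the two decomposition trees by an arbitrary edge; no vertex or edge of `H` needs bags on
both sides. -/
lemma TreewidthLE.union_of_forall_not_adj (hX : H.TreewidthLE X w) (hY : H.TreewidthLE Y w)
    (hXY : Disjoint X Y) (hadj : ∀ u ∈ X, ∀ v ∈ Y, ¬ H.Adj u v) : H.TreewidthLE (X ∪ Y) w := by
  obtain ⟨n, T, bag, hT, hb⟩ := hX
  obtain ⟨n', T', bag', hT', hb'⟩ := hY
  obtain ⟨i⟩ : Nonempty (Fin n) := hT.isTree.connected.nonempty
  obtain ⟨j⟩ : Nonempty (Fin n') := hT'.isTree.connected.nonempty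
  have hdec : H.IsTreeDecomposition (X ∪ Y) ((T ⊕g T') ⊔ edge (Sum.inl i) (Sum.inr j))
      (Sum.elim bag bag') := by
    refine ⟨hT.isTree.sum_sup_edge hT'.isTree i j, ?_, ?_, ?_, ?_⟩
    · rintro (a | a)
      · exact (hT.bag_subset a).trans subset_union_left
      · exact (hT'.bag_subset a).trans subset_union_right
    · intro v hv
      rcases mem_union.1 hv with hv | hv
      · obtain ⟨a, ha⟩ := hT.exists_mem_bag v hv
        exact ⟨Sum.inl a, ha⟩
      · obtain ⟨a, ha⟩ := hT'.exists_mem_bag v hv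
        exact ⟨Sum.inr a, ha⟩
    · intro u hu v hv huv
      rcases mem_union.1 hu with hu | hu <;> rcases mem_union.1 hv with hv | hv
      · obtain ⟨a, ha⟩ := hT.exists_adj_mem_bag u hu v hv huv
        exact ⟨Sum.inl a, ha⟩
      · exact (hadj u hu v hv huv).elim
      · exact (hadj v hv u hu huv.symm).elim
      · obtain ⟨a, ha⟩ := hT'.exists_adj_mem_bag u hu v hv huv
        exact ⟨Sum.inr a, ha⟩
    · intro v hv
      rcases mem_union.1 hv with hv | hv
      · have hv' : ∀ a, v ∉ bag' a := fun a ha => Finset.disjoint_left.1 hXY hv (hT'.bag_subset a ha)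
        let φ : T.induce {a | v ∈ bag a} →g ((T ⊕g T') ⊔ edge (Sum.inl i) (Sum.inr j)).induce
            {a | v ∈ Sum.elim bag bag' a} :=
          { toFun := fun a => ⟨Sum.inl a.1, a.2⟩
            map_rel' := fun {a b} hab => by
              simp only [comap_adj, Function.Embedding.subtype_apply, sup_adj, sum_adj_inl] at hab ⊢
              exact Or.inl hab }
        refine (hT.connected_bags v hv).map φ ?_
        rintro ⟨a | a, ha⟩
        · exact ⟨⟨a, ha⟩, rfl⟩
        · exact (hv' a ha).elim
      · have hv' : ∀ a, v ∉ bag a := fun a ha => Finset.disjoint_left.1 hXY (hT.bag_subset a ha) hv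
        let φ : T'.induce {a | v ∈ bag' a} →g ((T ⊕g T') ⊔ edge (Sum.inl i) (Sum.inr j)).induce
            {a | v ∈ Sum.elim bag bag' a} :=
          { toFun := fun a => ⟨Sum.inr a.1, a.2⟩
            map_rel' := fun {a b} hab => by
              simp only [comap_adj, Function.Embedding.subtype_apply, sup_adj, sum_adj_inr] at hab ⊢
              exact Or.inl hab }
        refine (hT'.connected_bags v hv).map φ ?_
        rintro ⟨a | a, ha⟩
        · exact (hv' a ha).elim
        · exact ⟨⟨a, ha⟩, rfl⟩
  exact hdec.treewidthLE (by rintro (a | a) <;> simp [hb, hb'])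

/-! ### Counting crossing edges -/

/-- The number of edges between `X` and `Y`, as ordered pairs in `X × Y`. -/
noncomputable def cross (H : SimpleGraph V) (X Y : Finset V) : ℕ :=
  ∑ u ∈ X, ∑ v ∈ Y, if H.Adj u v then 1 else 0

lemma cross_comm (X Y : Finset V) : H.cross X Y = H.cross Y X := by
  unfold cross
  rw [sum_comm]
  simp_rw [H.adj_comm]

lemma cross_union_left {Z : Finset V} (h : Disjoint X Y) :
    H.cross (X ∪ Y) Z = H.cross X Z + H.cross Y Z := sum_union h

lemma cross_union_right {Z : Finset V} (h : Disjoint X Y) :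
    H.cross Z (X ∪ Y) = H.cross Z X + H.cross Z Y := by
  rw [cross_comm, cross_union_left h, cross_comm X, cross_comm Y]

lemma cross_mono_right {Z : Finset V} (h : X ⊆ Y) : H.cross Z X ≤ H.cross Z Y :=
  sum_le_sum fun _ _ => sum_le_sum_of_subset h

lemma cross_mono_left {Z : Finset V} (h : X ⊆ Y) : H.cross X Z ≤ H.cross Y Z :=
  sum_le_sum_of_subset h

@[simp] lemma cross_empty_left : H.cross ∅ X = 0 := rfl

@[simp] lemma cross_empty_right : H.cross X ∅ = 0 := by simp [cross]

lemma cross_eq_sum_singleton : H.cross X Y = ∑ v ∈ X, H.cross {v} Y := by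
  simp [cross]

/-- Deleting from `X` the endpoints of crossing edges leaves no edge to `Y`; put them back into
every bag. -/
lemma TreewidthLE.union_cross (hX : H.TreewidthLE X w) (hY : H.TreewidthLE Y w)
    (hXY : Disjoint X Y) : H.TreewidthLE (X ∪ Y) (w + H.cross X Y) := by
  set C := X.filter fun u => ∃ v ∈ Y, H.Adj u v with hC
  have hCc : #C ≤ H.cross X Y := by
    calc #C = ∑ u ∈ C, 1 := by simp
      _ ≤ ∑ u ∈ C, ∑ v ∈ Y, (if H.Adj u v then 1 else 0) := by
          refine sum_le_sum fun u hu => ?_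
          obtain ⟨v, hv, huv⟩ := (mem_filter.1 hu).2
          calc 1 = if H.Adj u v then 1 else 0 := by simp [huv]
            _ ≤ _ := single_le_sum (f := fun v => if H.Adj u v then 1 else 0) (by simp) hv
      _ ≤ _ := cross_mono_left (filter_subset _ _)
  have h1 : H.TreewidthLE ((X \ C) ∪ Y) w := by
    refine (hX.subset sdiff_subset).union_of_forall_not_adj hY
      (hXY.mono_left sdiff_subset) ?_
    intro u hu v hv huv
    obtain ⟨hu, huC⟩ := mem_sdiff.1 hu
    exact huC (mem_filter.2 ⟨hu, v, hv, huv⟩)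
  refine ((h1.union_card C).subset ?_).mono_right (by omega)
  intro v hv
  simp only [mem_union, mem_sdiff] at hv ⊢
  tauto

/-! ### Branches and balanced cuts -/

/-- A union of connected components of `T - i`. -/
def IsBranchSet (T : SimpleGraph ι) (i : ι) (S : Finset ι) : Prop :=
  i ∉ S ∧ ∀ x ∈ S, ∀ y, T.Adj x y → y ∈ S ∨ y = i

lemma Preconnected.subset_of_forall_adj {T : SimpleGraph ι} {N : Set ι}
    (hN : (T.induce N).Preconnected) {S : Set ι} {x : ι} (hx : x ∈ N) (hxS : x ∈ S)
    (h : ∀ a ∈ N, ∀ b ∈ N, a ∈ S → T.Adj a b → b ∈ S) : N ⊆ S := by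
  intro y hy
  obtain ⟨p⟩ := hN ⟨x, hx⟩ ⟨y, hy⟩
  have key : ∀ (a b : N), (T.induce N).Walk a b → (a : ι) ∈ S → (b : ι) ∈ S := by
    intro a b p
    induction p with
    | nil => exact id
    | cons hab _ ih => exact fun ha => ih (h _ (Subtype.prop _) _ (Subtype.prop _) ha hab)
  exact key _ _ p hxS

/-- In a tree, a nonempty branch set at `i` splits into a branch at a neighbour `j` together with
`j`, and a smaller branch set at `i`. -/
lemma IsBranchSet.exists_split {T : SimpleGraph ι} (hT : T.IsTree) {i : ι} {S : Finset ι}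
    (hS : T.IsBranchSet i S) (hne : S.Nonempty) :
    ∃ j ∈ S, ∃ S₁ ⊆ S, ∃ S₂ ⊆ S, T.IsBranchSet j S₁ ∧ T.IsBranchSet i S₂ ∧ j ∉ S₂ ∧
      ∀ a ∈ S, a = j ∨ a ∈ S₁ ∨ a ∈ S₂ := by
  obtain ⟨j, hj, hij⟩ : ∃ j ∈ S, T.Adj i j := by
    by_contra! hcon
    obtain ⟨x, hx⟩ := hne
    obtain ⟨p⟩ := hT.connected.preconnected x i
    have key : ∀ (a b : ι), T.Walk a b → a ∈ S → b ∈ S := by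
      intro a b p
      induction p with
      | nil => exact id
      | @cons a b c hab _ ih =>
        intro ha
        refine ih ?_
        rcases hS.2 a ha b hab with h | rfl
        · exact h
        · exact (hcon a ha hab.symm).elim
    exact hS.1 (key _ _ p hx)
  -- In a tree the edge `ij` is a bridge: the component of `j` after its deletion lies in `S` and
  -- yields `S₁` on removing `j`; the rest of `S` is `S₂`.
  set D := T.deleteEdges {s(i, j)} with hD
  have hbr : ¬ D.Reachable i j :=
    isBridge_iff.1 (isAcyclic_iff_forall_adj_isBridge.1 hT.isAcyclic hij)
  have hstep : ∀ a b, D.Reachable j a → T.Adj a b → D.Reachable j b ∨ (a = j ∧ b = i) := by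
    intro a b ha hab
    by_cases he : s(a, b) = s(i, j)
    · rcases Sym2.eq_iff.1 he with ⟨rfl, rfl⟩ | ⟨rfl, rfl⟩
      · exact (hbr ha.symm).elim
      · exact Or.inr ⟨rfl, rfl⟩
    · exact Or.inl (ha.trans (Adj.reachable (by simp [hD, deleteEdges_adj, hab, he])))
  have hsub : ∀ a, D.Reachable j a → a ∈ S := by
    rintro a ⟨p⟩
    have key : ∀ (a b : ι), D.Walk a b → D.Reachable j a → a ∈ S → b ∈ S := by
      intro a b p
      induction p with
      | nil => exact fun _ h => h
      | @cons a b c hab _ ih =>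
        intro hja ha
        have hjb := hja.trans hab.reachable
        refine ih hjb ?_
        rcases hS.2 a ha b ((deleteEdges_le _) hab) with h | rfl
        · exact h
        · exact (hbr hjb.symm).elim
    exact key _ _ p (Reachable.refl _) hj
  refine ⟨j, hj, S.filter fun a => D.Reachable j a ∧ a ≠ j, filter_subset _ _,
    S.filter fun a => ¬ D.Reachable j a, filter_subset _ _, ⟨by simp, ?_⟩, ⟨?_, ?_⟩, ?_, ?_⟩
  · intro x hx y hxy
    obtain ⟨-, hjx, hne⟩ := mem_filter.1 hx
    rcases hstep x y hjx hxy with h | h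
    · by_cases hyj : y = j
      · exact Or.inr hyj
      · exact Or.inl (mem_filter.2 ⟨hsub y h, h, hyj⟩)
    · exact (hne h.1).elim
  · exact fun h => hS.1 (mem_filter.1 h).1
  · intro x hx y hxy
    obtain ⟨hxS, hjx⟩ := mem_filter.1 hx
    rcases hS.2 x hxS y hxy with h | h
    · refine Or.inl (mem_filter.2 ⟨h, fun hjy => ?_⟩)
      rcases hstep y x hjy hxy.symm with h' | ⟨-, rfl⟩
      · exact hjx h'
      · exact hS.1 hxS
    · exact Or.inr h
  · simp
  · intro a ha
    simp only [mem_filter]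
    tauto

/-- The vertices of `X` outside the bag at `i` that lie in some bag of `S`. -/
noncomputable def branchVerts (X : Finset V) (bag : ι → Finset V) (i : ι) (S : Finset ι) :
    Finset V :=
  X.filter fun v => v ∉ bag i ∧ ∃ x ∈ S, v ∈ bag x

lemma mem_branchVerts {bag : ι → Finset V} {i : ι} {S : Finset ι} {v : V} :
    v ∈ branchVerts X bag i S ↔ v ∈ X ∧ v ∉ bag i ∧ ∃ x ∈ S, v ∈ bag x := mem_filter

lemma branchVerts_subset {bag : ι → Finset V} {i : ι} {S : Finset ι} :
    branchVerts X bag i S ⊆ X := filter_subset _ _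

/-- The subtree of `u` avoids `i`, hence stays in `S`; so the bag holding both `u` and `v` is in
`S`, and only membership in the bag at `i` keeps `v` out of the branch. -/
lemma IsTreeDecomposition.mem_bag_of_adj {T : SimpleGraph ι} {bag : ι → Finset V}
    (h : H.IsTreeDecomposition X T bag) {i : ι} {S : Finset ι} (hS : T.IsBranchSet i S) {u v : V}
    (hu : u ∈ branchVerts X bag i S) (hv : v ∈ X \ branchVerts X bag i S) (huv : H.Adj u v) :
    v ∈ bag i := by
  obtain ⟨huX, hui, x, hxS, hux⟩ := mem_branchVerts.1 hu
  obtain ⟨hvX, hvB⟩ := mem_sdiff.1 hv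
  obtain ⟨z, huz, hvz⟩ := h.exists_adj_mem_bag u huX v hvX huv
  have hsub : {a | u ∈ bag a} ⊆ (S : Set ι) := by
    refine (h.connected_bags u huX).preconnected.subset_of_forall_adj (x := x) hux
      (mem_coe.2 hxS) ?_
    intro a _ b hb haS hab
    rcases hS.2 a haS b hab with h | rfl
    · exact h
    · exact (hui hb).elim
  by_contra hvi
  exact hvB (mem_branchVerts.2 ⟨hvX, hvi, z, hsub huz, hvz⟩)

lemma sum_union_le_add (μ : V → ℕ) (X Y : Finset V) :
    ∑ v ∈ X ∪ Y, μ v ≤ ∑ v ∈ X, μ v + ∑ v ∈ Y, μ v := by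
  rw [← sum_union_inter]
  exact Nat.le_add_right _ _

/-- A weighted set of bounded treewidth and bounded degree has a balanced cut with few edges. -/
lemma TreewidthLE.exists_balanced_cut {U : Finset V} {Δ : ℕ} (hX : H.TreewidthLE X w)
    (hXU : X ⊆ U) (hdeg : ∀ v ∈ U, H.cross {v} U ≤ Δ) (μ : V → ℕ) (hμ : ∀ v ∈ X, μ v ≤ Δ)
    (hW : 3 * ((w + 1) * Δ) < 2 * ∑ v ∈ X, μ v) :
    ∃ Y ⊆ X, H.cross Y (X \ Y) ≤ (w + 1) * Δ ∧ ∑ v ∈ X, μ v < 3 * ∑ v ∈ Y, μ v ∧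
      3 * ∑ v ∈ Y, μ v ≤ 2 * (∑ v ∈ X, μ v) + 3 * ((w + 1) * Δ) := by
  obtain ⟨n, T, bag, hT, hb⟩ := hX
  have hbag : ∀ i, ∑ v ∈ bag i, μ v ≤ (w + 1) * Δ := fun i =>
    calc ∑ v ∈ bag i, μ v ≤ ∑ v ∈ bag i, Δ := sum_le_sum fun v hv => hμ v (hT.bag_subset i hv)
      _ = #(bag i) * Δ := by simp
      _ ≤ _ := Nat.mul_le_mul_right _ (hb i)
  obtain ⟨i₀⟩ : Nonempty (Fin n) := hT.isTree.connected.nonempty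
  set F : Finset (Fin n × Finset (Fin n)) := univ.filter fun p =>
    T.IsBranchSet p.1 p.2 ∧ ∑ v ∈ X, μ v < 3 * ∑ v ∈ branchVerts X bag p.1 p.2, μ v with hF
  have hFne : F.Nonempty := by
    refine ⟨(i₀, univ.erase i₀), mem_filter.2 ⟨mem_univ _, ⟨by simp, fun x _ y _ => ?_⟩, ?_⟩⟩
    · by_cases h : y = i₀ <;> simp [h]
    · have hsub : X ⊆ branchVerts X bag i₀ (univ.erase i₀) ∪ bag i₀ := by
        intro v hv
        by_cases hvi : v ∈ bag i₀
        · exact mem_union_right _ hvi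
        · obtain ⟨x, hx⟩ := hT.exists_mem_bag v hv
          refine mem_union_left _ (mem_branchVerts.2 ⟨hv, hvi, x, ?_, hx⟩)
          simp only [mem_erase, mem_univ, and_true]
          rintro rfl
          exact hvi hx
      have h1 := (sum_le_sum_of_subset (f := μ) hsub).trans (sum_union_le_add μ _ _)
      have h2 := hbag i₀
      dsimp only
      omega
  -- A smallest branch set carrying over a third of the weight splits into two branches of at most a
  -- third each, plus one bag.
  obtain ⟨⟨i, S⟩, hiS, hmin⟩ := F.exists_min_image (fun p => #p.2) hFne
  obtain ⟨-, hS, hlarge⟩ := mem_filter.1 hiS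
  dsimp only at hS hlarge
  refine ⟨branchVerts X bag i S, branchVerts_subset, ?_, hlarge, ?_⟩
  · set B := branchVerts X bag i S with hB
    calc H.cross B (X \ B) ≤ H.cross B (bag i ∩ U) := by
          refine sum_le_sum fun u hu => ?_
          rw [← sum_filter_add_sum_filter_not (X \ B) (fun v => v ∈ bag i)]
          have h0 : ∑ v ∈ (X \ B).filter (fun v => v ∉ bag i), (if H.Adj u v then 1 else 0) = 0 := by
            refine sum_eq_zero fun v hv => ?_
            obtain ⟨hv, hvi⟩ := mem_filter.1 hv
            exact if_neg fun huv => hvi (hT.mem_bag_of_adj hS hu hv huv)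
          rw [h0, add_zero]
          refine sum_le_sum_of_subset fun v hv => ?_
          obtain ⟨hv, hvi⟩ := mem_filter.1 hv
          exact mem_inter.2 ⟨hvi, hXU (mem_sdiff.1 hv).1⟩
      _ = ∑ v ∈ bag i ∩ U, H.cross {v} B := by rw [cross_comm, cross_eq_sum_singleton]
      _ ≤ ∑ v ∈ bag i ∩ U, Δ := sum_le_sum fun v hv =>
          (cross_mono_right (branchVerts_subset.trans hXU)).trans (hdeg v (mem_inter.1 hv).2)
      _ = #(bag i ∩ U) * Δ := by simp
      _ ≤ _ := Nat.mul_le_mul_right _ ((card_le_card inter_subset_left).trans (hb i))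
  · have hne : S.Nonempty := by
      rw [nonempty_iff_ne_empty]
      rintro rfl
      simp [branchVerts] at hlarge
    obtain ⟨j, hj, S₁, hS₁, S₂, hS₂, hj₁, hi₂, hj₂, hSeq⟩ := hS.exists_split hT.isTree hne
    have hsmall : ∀ a S', T.IsBranchSet a S' → #S' < #S →
        3 * ∑ v ∈ branchVerts X bag a S', μ v ≤ ∑ v ∈ X, μ v := by
      intro a S' hS' hcard
      by_contra! hcon
      exact absurd (hmin (a, S') (mem_filter.2 ⟨mem_univ _, hS', hcon⟩)) (not_le.2 hcard)
    have h1 := hsmall j S₁ hj₁ (card_lt_card ⟨hS₁, fun h => hj₁.1 (h hj)⟩)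
    have h2 := hsmall i S₂ hi₂ (card_lt_card ⟨hS₂, fun h => hj₂ (h hj)⟩)
    have hsub : branchVerts X bag i S ⊆
        (branchVerts X bag j S₁ ∪ branchVerts X bag i S₂) ∪ bag j := by
      intro v hv
      obtain ⟨hvX, hvi, x, hx, hvx⟩ := mem_branchVerts.1 hv
      simp only [mem_union, mem_branchVerts]
      by_cases hvj : v ∈ bag j
      · exact Or.inr hvj
      rcases hSeq x hx with rfl | hx | hx
      · exact Or.inr hvx
      · exact Or.inl (Or.inl ⟨hvX, hvj, x, hx, hvx⟩)
      · exact Or.inl (Or.inr ⟨hvX, hvi, x, hx, hvx⟩)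
    have h3 := (sum_le_sum_of_subset (f := μ) hsub).trans (sum_union_le_add μ _ _)
    have h4 := sum_union_le_add μ (branchVerts X bag j S₁) (branchVerts X bag i S₂)
    have h5 := hbag j
    omega

/-! ### Cutting a set into pieces of small boundary -/

lemma cross_sdiff_of_subset {U P : Finset V} (hPU : P ⊆ U) (hY : Y ⊆ P) :
    H.cross Y (U \ Y) = H.cross Y (U \ P) + H.cross Y (P \ Y) := by
  rw [← cross_union_right]
  · congr 1
    ext v
    have := @hPU v
    have := @hY v
    simp only [mem_sdiff, mem_union]
    tauto
  · exact disjoint_sdiff_self_left.mono_right sdiff_subset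

lemma cross_filter_add_filter_not (p : V → Prop) (X Y : Finset V) :
    H.cross (X.filter p) Y + H.cross (X.filter fun v => ¬ p v) Y = H.cross X Y := by
  rw [← cross_union_left (disjoint_filter_filter_not _ _ _), filter_union_filter_not_eq]

/-- A set of bounded treewidth and bounded degree can be cut into pieces of small edge boundary
such that few edges join different pieces, compared with the boundary of the set. -/
lemma TreewidthLE.exists_pieces {U : Finset V} {Δ : ℕ} (hdeg : ∀ v ∈ U, H.cross {v} U ≤ Δ)
    {P : Finset V} (hPU : P ⊆ U) (hP : H.TreewidthLE P w) :
    ∃ f : V → ℕ,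
      (∀ c, H.cross (P.filter fun v => f v = c) (U \ P.filter fun v => f v = c) ≤
        54 * ((w + 1) * Δ)) ∧
      ∀ S : Set ℕ, 16 * H.cross (P.filter fun v => f v ∈ S) (P.filter fun v => f v ∉ S) ≤
        H.cross P (U \ P) - 18 * ((w + 1) * Δ) := by
  induction hW : H.cross P (U \ P) using Nat.strong_induction_on generalizing P with
  | _ W ih =>
  subst hW
  set s := (w + 1) * Δ with hs
  by_cases hsmall : H.cross P (U \ P) ≤ 54 * s
  · refine ⟨fun _ => 0, fun c => ?_, fun S => ?_⟩
    · by_cases hc : 0 = c <;> simp [hc, hsmall]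
    · by_cases hS : 0 ∈ S <;> simp [hS]
  push Not at hsmall
  have hμ : ∀ v ∈ P, H.cross {v} (U \ P) ≤ Δ := fun v hv =>
    (cross_mono_right sdiff_subset).trans (hdeg v (hPU hv))
  -- Weigh vertices by edges leaving `P`. Boundaries above `54 * s` shrink strictly in both parts.
  -- The two boundaries sum to at most `2 * s` more than that of `P`, and the cut costs `16 * s`;
  -- the extra `- 18 * s` gained from having two parts pays for both.
  obtain ⟨Y, hYP, hcut, hY₁, hY₂⟩ := hP.exists_balanced_cut hPU hdeg
    (fun v => H.cross {v} (U \ P)) hμ (by rw [← cross_eq_sum_singleton]; omega)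
  rw [← cross_eq_sum_singleton, ← cross_eq_sum_singleton] at hY₁ hY₂
  rw [← hs] at hcut hY₂
  have hdisj : Disjoint Y (P \ Y) := disjoint_sdiff
  have hYZ : Y ∪ (P \ Y) = P := union_sdiff_of_subset hYP
  have hbY := cross_sdiff_of_subset (H := H) hPU hYP
  have hbZ := cross_sdiff_of_subset (H := H) hPU (sdiff_subset : P \ Y ⊆ P)
  rw [Finset.sdiff_sdiff_eq_self hYP, cross_comm (P \ Y) Y] at hbZ
  have htot : H.cross Y (U \ P) + H.cross (P \ Y) (U \ P) = H.cross P (U \ P) := by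
    rw [← cross_union_left hdisj, hYZ]
  obtain ⟨f, hf₁, hf₂⟩ := ih (H.cross Y (U \ Y)) (by omega) (hYP.trans hPU) (hP.subset hYP) rfl
  obtain ⟨g, hg₁, hg₂⟩ := ih (H.cross (P \ Y) (U \ (P \ Y))) (by omega)
    (sdiff_subset.trans hPU) (hP.subset sdiff_subset) rfl
  -- Even and odd labels keep the pieces of the two parts distinct.
  set F : V → ℕ := fun v => if v ∈ Y then 2 * f v else 2 * g v + 1 with hF
  have hfilt : ∀ S : Set ℕ, P.filter (fun v => F v ∈ S) =
      (Y.filter fun v => f v ∈ {c | 2 * c ∈ S}) ∪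
        ((P \ Y).filter fun v => g v ∈ {c | 2 * c + 1 ∈ S}) := by
    intro S
    ext v
    have := @hYP v
    by_cases hv : v ∈ Y
    · simp [hF, hv, this hv]
    · simp [hF, hv]
  refine ⟨F, fun c => ?_, fun S => ?_⟩
  · rcases Nat.even_or_odd' c with ⟨d, rfl | rfl⟩
    · have : P.filter (fun v => F v = 2 * d) = Y.filter fun v => f v = d := by
        have h := hfilt {2 * d}
        simp only [Set.mem_singleton_iff, Set.mem_ofPred_eq] at h
        rw [h]
        ext v
        simp only [mem_union, mem_filter]
        constructor
        · rintro (h | h)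
          · exact ⟨h.1, by omega⟩
          · omega
        · exact fun h => Or.inl ⟨h.1, by omega⟩
      rw [this]
      exact hf₁ d
    · have : P.filter (fun v => F v = 2 * d + 1) = (P \ Y).filter fun v => g v = d := by
        have h := hfilt {2 * d + 1}
        simp only [Set.mem_singleton_iff, Set.mem_ofPred_eq] at h
        rw [h]
        ext v
        simp only [mem_union, mem_filter]
        constructor
        · rintro (h | h)
          · omega
          · exact ⟨h.1, by omega⟩
        · exact fun h => Or.inr ⟨h.1, by omega⟩
      rw [this]
      exact hg₁ d
  · have h1 := hfilt S
    have h2 := hfilt Sᶜ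
    simp only [Set.mem_compl_iff] at h2
    rw [h1, h2]
    have hf := hf₂ {c | 2 * c ∈ S}
    have hg := hg₂ {c | 2 * c + 1 ∈ S}
    simp only [Set.mem_ofPred_eq] at hf hg ⊢
    rw [cross_union_left (disjoint_filter_filter hdisj),
      cross_union_right (disjoint_filter_filter hdisj),
      cross_union_right (disjoint_filter_filter hdisj)]
    have e1 := cross_filter_add_filter_not (H := H) (fun v => 2 * f v ∈ S) Y (P \ Y)
    have e2 := cross_mono_right (H := H) (Z := Y.filter fun v => 2 * f v ∈ S)
      (filter_subset (fun v => 2 * g v + 1 ∉ S) (P \ Y))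
    have e3 := cross_comm (H := H) ((P \ Y).filter fun v => 2 * g v + 1 ∈ S)
      (Y.filter fun v => 2 * f v ∉ S)
    have e4 := cross_mono_right (H := H) (Z := Y.filter fun v => 2 * f v ∉ S)
      (filter_subset (fun v => 2 * g v + 1 ∈ S) (P \ Y))
    omega

/-! ### The exchange argument -/

/-- One can pass from `∅` to `I` by inserting single elements so that
`∑ c ∈ S, y c + ∑ c ∈ I \ S, x c` stays below its bound at the two ends; hence a property that
holds for `∅` and not for `I` is lost at some step of such a process. -/
lemma exists_insert_switch [DecidableEq κ] (I : Finset κ) (x y : κ → ℕ) (h : ℕ)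
    (hx : ∑ c ∈ I, x c ≤ h)
    (hy : ∑ c ∈ I, y c ≤ h) (p : Finset κ → Prop) (h0 : p ∅) (h1 : ¬ p I) :
    ∃ S ⊆ I, ∃ c ∈ I \ S, p S ∧ ¬ p (insert c S) ∧
      ∑ a ∈ insert c S, y a + ∑ a ∈ I \ insert c S, x a ≤ h := by
  set q : Finset κ → ℕ := fun S => ∑ a ∈ S, y a + ∑ a ∈ I \ S, x a with hq
  obtain ⟨S, hS, hmax⟩ := (I.powerset.filter fun S => p S ∧ q S ≤ h).exists_max_image
    (fun S => #S) ⟨∅, by simp [h0, hq, hx]⟩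
  simp only [mem_filter, mem_powerset] at hS hmax
  obtain ⟨hSI, hpS, hqS⟩ := hS
  have hins : ∀ c ∈ I \ S, q (insert c S) + x c = q S + y c := by
    intro c hc
    have hcS := (mem_sdiff.1 hc).2
    simp only [hq]
    rw [sum_insert hcS, ← sum_erase_add _ _ hc, sdiff_insert]
    ring
  suffices hex : ∃ c ∈ I \ S, q (insert c S) ≤ h by
    obtain ⟨c, hc, hqc⟩ := hex
    refine ⟨S, hSI, c, hc, hpS, fun hp => ?_, hqc⟩
    have := hmax (insert c S) ⟨insert_subset (mem_sdiff.1 hc).1 hSI, hp, hqc⟩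
    rw [card_insert_of_notMem (mem_sdiff.1 hc).2] at this
    omega
  -- Insert elements with `y c ≤ x c` first: these do not increase `q`. Once none remains, replacing
  -- `x` by `y` on the rest bounds `q` by `∑ c ∈ I, y c`.
  by_cases hle : ∃ c ∈ I \ S, y c ≤ x c
  · obtain ⟨c, hc, hcle⟩ := hle
    exact ⟨c, hc, by have := hins c hc; omega⟩
  · push Not at hle
    obtain ⟨c, hc⟩ : (I \ S).Nonempty := by
      rw [sdiff_nonempty]
      intro hIS
      exact h1 (hIS.antisymm hSI ▸ hpS)
    refine ⟨c, hc, ?_⟩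
    have hcS := (mem_sdiff.1 hc).2
    have hsub : insert c S ⊆ I := insert_subset (mem_sdiff.1 hc).1 hSI
    calc q (insert c S) ≤ ∑ a ∈ insert c S, y a + ∑ a ∈ I \ insert c S, y a := by
          refine Nat.add_le_add_left (sum_le_sum fun a ha => (hle a ?_).le) _
          exact sdiff_subset_sdiff subset_rfl (subset_insert _ _) ha
      _ = ∑ a ∈ I, y a := by rw [add_comm, sum_sdiff hsub]
      _ ≤ h := hy

lemma cross_filter_mem_eq_sum [DecidableEq κ] (f : V → κ) (S : Finset κ) (X Y : Finset V) :
    H.cross (X.filter fun v => f v ∈ S) Y = ∑ c ∈ S, H.cross (X.filter fun v => f v = c) Y := by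
  unfold cross
  rw [← sum_fiberwise_of_maps_to (s := X.filter fun v => f v ∈ S) (t := S) (g := f)
    (fun v hv => (mem_filter.1 hv).2)]
  refine sum_congr rfl fun c hc => sum_congr ?_ fun _ _ => rfl
  ext v
  simp only [mem_filter]
  constructor
  · exact fun h => ⟨h.1.1, h.2⟩
  · exact fun h => ⟨⟨h.1, h.2 ▸ hc⟩, h.2⟩

/-- A partition into two sets of treewidth at most `R` that minimizes the number of crossing
edges, the first set having treewidth at most `t`. -/
lemma exists_minimal_partition {U : Finset V} {t R : ℕ} (htR : t + 1 ≤ R)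
    (hU : ¬ H.TreewidthLE U R) (hpart : ∀ A ⊆ U, H.TreewidthLE A t ∨ H.TreewidthLE (U \ A) t) :
    ∃ A ⊆ U, H.TreewidthLE A t ∧ H.TreewidthLE (U \ A) R ∧
      ∀ A' ⊆ U, H.TreewidthLE A' R → H.TreewidthLE (U \ A') R →
        H.cross A (U \ A) ≤ H.cross A' (U \ A') := by
  have hne : (U.powerset.filter fun A =>
      H.TreewidthLE A R ∧ H.TreewidthLE (U \ A) R).Nonempty := by
    -- One more vertex pushes a maximal `A` above `R`, so the complement drops to `t`; restoring
    -- that vertex costs one, hence `t + 1 ≤ R`.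
    obtain ⟨A, hA, hmax⟩ := (U.powerset.filter fun A => H.TreewidthLE A R).exists_max_image
      (fun A => #A) ⟨∅, by simp [treewidthLE_empty]⟩
    simp only [mem_filter, mem_powerset] at hA hmax
    obtain ⟨v, hv⟩ : (U \ A).Nonempty := by
      rw [sdiff_nonempty]
      intro hUA
      exact hU (hUA.antisymm hA.1 ▸ hA.2)
    obtain ⟨hvU, hvA⟩ := mem_sdiff.1 hv
    refine ⟨A, mem_filter.2 ⟨mem_powerset.2 hA.1, hA.2, ?_⟩⟩
    have hins : insert v A ⊆ U := insert_subset hvU hA.1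
    have hbig : ¬ H.TreewidthLE (insert v A) R := fun h => by
      have := hmax _ ⟨hins, h⟩
      rw [card_insert_of_notMem hvA] at this
      omega
    have hsmall := (hpart _ hins).resolve_left fun h => hbig (h.mono_right (by omega))
    refine ((hsmall.union_card {v}).subset ?_).mono_right (by simpa using htR)
    intro u hu
    simp only [mem_union, mem_sdiff, mem_insert, mem_singleton] at hu ⊢
    tauto
  obtain ⟨A, hA, hmin⟩ := exists_min_image _ (fun A => H.cross A (U \ A)) hne
  simp only [mem_filter, mem_powerset] at hA hmin
  rcases hpart A hA.1 with h | h
  · exact ⟨A, hA.1, h, hA.2.2, fun A' h1 h2 h3 => hmin A' ⟨h1, h2, h3⟩⟩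
  · refine ⟨U \ A, sdiff_subset, h, ?_, fun A' h1 h2 h3 => ?_⟩
    · rw [Finset.sdiff_sdiff_eq_self hA.1]
      exact hA.2.1
    · rw [Finset.sdiff_sdiff_eq_self hA.1, cross_comm]
      exact hmin A' ⟨h1, h2, h3⟩

/-- A graph of maximum degree `Δ` whose treewidth is large compared with `t * Δ ^ 2` can be
partitioned into two induced subgraphs of treewidth larger than `t`. -/
theorem exists_partition_not_treewidthLE {U : Finset V} {Δ t : ℕ} (hΔ : 1 ≤ Δ)
    (hdeg : ∀ v ∈ U, H.cross {v} U ≤ Δ)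
    (hU : ∀ k, H.TreewidthLE U k → 500 * ((t + 1) * Δ ^ 2) ≤ k) :
    ∃ A ⊆ U, ¬ H.TreewidthLE A t ∧ ¬ H.TreewidthLE (U \ A) t := by
  by_contra! hcon
  have hpart : ∀ A ⊆ U, H.TreewidthLE A t ∨ H.TreewidthLE (U \ A) t := fun A hA =>
    or_iff_not_imp_left.2 (hcon A hA)
  set s := (t + 1) * Δ with hs
  set K := (t + 1) * Δ ^ 2 with hK
  have hts : t + 1 ≤ s := Nat.le_mul_of_pos_right _ hΔ
  have hKs : K = s * Δ := by rw [hK, hs]; ring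
  have hsK : s ≤ K := hKs ▸ Nat.le_mul_of_pos_right _ hΔ
  set R := t + 54 * s with hR
  have hRK : (R + 1) * Δ = s + 54 * K := by rw [hR, hKs, hs]; ring
  obtain ⟨A, hAU, hAt, hBR, hmin⟩ := exists_minimal_partition (H := H) (t := t) (R := R)
    (by omega) (fun h => by have := hU R h; omega) hpart
  set B := U \ A with hB
  set m := H.cross A B with hm
  have hAB : Disjoint A B := disjoint_sdiff
  have hBU : B ⊆ U := sdiff_subset
  have hmK : 500 * K ≤ R + m := by
    refine hU _ (((hAt.mono_right (by omega)).union_cross hBR hAB).subset ?_)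
    exact (union_sdiff_of_subset hAU).ge
  have hmB : ∑ v ∈ B, H.cross {v} A = m := by rw [← cross_eq_sum_singleton, cross_comm]
  obtain ⟨B₁, hB₁, hcutB, hlow, hhigh⟩ := hBR.exists_balanced_cut hBU hdeg
    (fun v => H.cross {v} A)
    (fun v hv => (cross_mono_right hAU).trans (hdeg v (hBU hv)))
    (by rw [hmB, hRK]; omega)
  rw [hmB, ← cross_eq_sum_singleton, cross_comm] at hlow hhigh
  rw [hRK] at hcutB hhigh
  set B₂ := B \ B₁ with hB₂
  have hB₁₂ : Disjoint B₁ B₂ := disjoint_sdiff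
  have hB₂B : B₂ ⊆ B := sdiff_subset
  have hsumB : H.cross A B₁ + H.cross A B₂ = m := by
    rw [← cross_union_right hB₁₂, union_sdiff_of_subset hB₁]
  obtain ⟨f, hf₁, hf₂⟩ := hAt.exists_pieces hdeg hAU
  rw [← hs] at hf₁ hf₂
  let piece : ℕ → Finset V := fun c => A.filter fun v => f v = c
  set I := A.image f with hI
  let side : Finset ℕ → Finset V := fun S => (A.filter fun v => f v ∈ S) ∪ B₁
  have hAI : A.filter (fun v => f v ∈ I) = A :=
    filter_true_of_mem fun v hv => mem_image_of_mem f hv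
  have hside : ∀ S, side S ⊆ U := fun S =>
    union_subset ((filter_subset _ _).trans hAU) (hB₁.trans hBU)
  have hcompl : ∀ S, U \ side S = (A.filter fun v => f v ∉ S) ∪ B₂ := by
    intro S
    ext v
    have h1 := @hAU v
    have h2 := @hB₁ v
    simp only [side, hB₂, hB, mem_sdiff, mem_union, mem_filter] at h1 h2 ⊢
    tauto
  have hq : ∀ S ⊆ I, H.cross (side S) (U \ side S) =
      H.cross (A.filter fun v => f v ∈ S) (A.filter fun v => f v ∉ S) + H.cross B₁ B₂ +
        (∑ c ∈ S, H.cross (piece c) B₂ + ∑ c ∈ I \ S, H.cross (piece c) B₁) := by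
    intro S hS
    have hnot : (A.filter fun v => f v ∉ S) = A.filter fun v => f v ∈ I \ S := by
      refine filter_congr fun v hv => ?_
      simp [hI, mem_sdiff, mem_image_of_mem f hv]
    rw [hcompl, cross_union_left, cross_union_right, cross_union_right,
      ← cross_filter_mem_eq_sum f S A B₂, ← cross_filter_mem_eq_sum f (I \ S) A B₁, ← hnot,
      cross_comm B₁ (filter _ _)]
    · ring
    · exact hAB.mono (filter_subset _ _) hB₂B
    · exact hAB.mono (filter_subset _ _) hB₂B
    · exact hAB.mono (filter_subset _ _) hB₁
  -- By `hq` the cut has at most `(m - 18 * s) / 16 + (s + 54 * K) + (2 * m / 3 + s + 54 * K)`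
  -- edges. This is below `m`, since `R ≤ 55 * K` gives `m ≥ 445 * K`.
  have hfew : ∀ S ⊆ I,
      ∑ c ∈ S, H.cross (piece c) B₂ + ∑ c ∈ I \ S, H.cross (piece c) B₁ ≤
        (2 * m + 3 * (s + 54 * K)) / 3 →
      H.TreewidthLE (side S) R → ¬ H.TreewidthLE (U \ side S) R := by
    intro S hS hle h1 h2
    have h3 := hmin (side S) (hside S) h1 h2
    have h4 := hq S hS
    have h5 : 16 * H.cross (A.filter fun v => f v ∈ S) (A.filter fun v => f v ∉ S) ≤
      m - 18 * s := by
      convert hf₂ (S : Set ℕ) <;> exact mem_coe.symm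
    omega
  have hx : ∑ c ∈ I, H.cross (piece c) B₁ = H.cross A B₁ := by
    rw [← cross_filter_mem_eq_sum f I A B₁, hAI]
  have hy : ∑ c ∈ I, H.cross (piece c) B₂ = H.cross A B₂ := by
    rw [← cross_filter_mem_eq_sum f I A B₂, hAI]
  obtain ⟨S, hSI, c, hc, hS, hcS, hle⟩ := exists_insert_switch I
    (fun c => H.cross (piece c) B₁) (fun c => H.cross (piece c) B₂)
    ((2 * m + 3 * (s + 54 * K)) / 3) (by rw [hx]; omega) (by rw [hy]; omega)
    (fun S => H.TreewidthLE (side S) t)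
    (by
      refine (hpart _ (hside ∅)).resolve_right fun h => ?_
      refine hfew ∅ (empty_subset _) ?_ (hBR.subset ?_) (h.mono_right (by omega))
      · rw [sum_empty, sdiff_empty, hx]
        omega
      · simpa [side] using hB₁)
    (by
      intro h
      refine hfew I subset_rfl ?_ (h.mono_right (by omega)) (hBR.subset ?_)
      · rw [Finset.sdiff_self, sum_empty, hy]
        omega
      · rw [hcompl, filter_false_of_mem, empty_union]
        · exact hB₂B
        · exact fun v hv => not_not.2 (mem_image_of_mem f hv))
  have hinsI : insert c S ⊆ I := insert_subset (mem_sdiff.1 hc).1 hSI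
  have hdisj : Disjoint (piece c) (side S) := by
    rw [Finset.disjoint_left]
    intro v hv hv'
    obtain ⟨hvA, rfl⟩ := mem_filter.1 hv
    rcases mem_union.1 hv' with h | h
    · exact (mem_sdiff.1 hc).2 (mem_filter.1 h).2
    · exact Finset.disjoint_left.1 hAB hvA (hB₁ h)
  have hgrow : H.TreewidthLE (side (insert c S)) R := by
    have h1 := ((hAt.subset (filter_subset _ _)).union_cross hS hdisj)
    refine (h1.subset ?_).mono_right ?_
    · intro v hv
      simp only [side, mem_union, mem_filter, mem_insert] at hv ⊢
      tauto
    · have h2 : H.cross (piece c) (side S) ≤ H.cross (piece c) (U \ piece c) :=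
        cross_mono_right fun v hv =>
          mem_sdiff.2 ⟨hside S hv, fun hv' => Finset.disjoint_left.1 hdisj hv' hv⟩
      have h3 : H.cross (piece c) (side S) ≤ 54 * s := h2.trans (hf₁ c)
      exact Nat.add_le_add_left h3 t
  exact hfew _ hinsI hle hgrow
    (((hpart _ (hside _)).resolve_left hcS).mono_right (by omega))

end SimpleGraph

/-! ### Transfer to multigraphs -/

namespace Graph

open Finset
open scoped Classical

variable {V E : Type*}

/-- The simple graph on all of `V` with the adjacency of `G`, loops removed. -/
def adjGraph (G : Graph V E) : SimpleGraph V where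
  Adj u v := u ≠ v ∧ G.Adj u v
  symm := ⟨fun _ _ h => ⟨h.1.symm, h.2.symm⟩⟩
  loopless := ⟨fun _ h => h.1 rfl⟩

lemma induce_adj_iff {G : Graph V E} {X : Set V} {u v : V} :
    (G.induce X).Adj u v ↔ G.Adj u v ∧ u ∈ X ∧ v ∈ X := by
  simp [Graph.Adj]

lemma treewidthLE_adjGraph_iff {G : Graph V E} {X : Finset V} {w : ℕ} :
    G.adjGraph.TreewidthLE X w ↔
      ∃ (n : ℕ) (D : (G.induce (X : Set V)).TreeDecomposition (Fin n)),
        ∀ i, #(D.bag i) ≤ w + 1 := by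
  constructor
  · rintro ⟨n, T, bag, hT, hw⟩
    refine ⟨n, ⟨T, hT.isTree, bag, fun i v hv => hT.bag_subset i hv,
      fun v hv => hT.exists_mem_bag v hv, fun u v huv => ?_, fun v hv => hT.connected_bags v hv⟩,
      hw⟩
    obtain ⟨huv, hu, hv⟩ := induce_adj_iff.1 huv
    by_cases hne : u = v
    · subst hne
      obtain ⟨i, hi⟩ := hT.exists_mem_bag u hu
      exact ⟨i, hi, hi⟩
    · exact hT.exists_adj_mem_bag u hu v hv ⟨hne, huv⟩
  · rintro ⟨n, D, hw⟩
    exact ⟨n, D.tree, D.bag, ⟨D.isTree, fun i v hv => D.bag_subset i v hv,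
      fun v hv => D.exists_mem_bag v hv,
      fun u hu v hv huv => D.exists_adj_mem_bag u v (induce_adj_iff.2 ⟨huv.2, hu, hv⟩),
      fun v hv => D.connected_bags v hv⟩, hw⟩

lemma treewidthLE_adjGraph_iff_treewidth_le {G : Graph V E} {X : Finset V} {w : ℕ} :
    G.adjGraph.TreewidthLE X w ↔ (G.induce (X : Set V)).treewidth ≤ w := by
  constructor
  · exact fun h => Nat.sInf_le (treewidthLE_adjGraph_iff.1 h)
  · intro h
    -- Nonemptiness of the set matters: the infimum of the empty set would be the default `0`.
    have hmem : (G.induce (X : Set V)).treewidth ∈ _ :=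
      Nat.sInf_mem ⟨#X, treewidthLE_adjGraph_iff.1 (SimpleGraph.treewidthLE_card _ X)⟩
    exact (treewidthLE_adjGraph_iff.2 hmem).mono_right h

/-- Choosing one edge to each neighbour is injective, since an edge at `v` determines its other end.
-/
lemma cross_adjGraph_le {G : Graph V E} {U : Finset V} {v : V} {Δ : ℕ}
    (h : G.eDegree v ≤ Δ) : G.adjGraph.cross {v} U ≤ Δ := by
  have hcard : G.adjGraph.cross {v} U = #(U.filter fun u => G.adjGraph.Adj v u) := by
    simp [SimpleGraph.cross]
  rw [hcard]
  have hex : ∀ u ∈ U.filter fun u => G.adjGraph.Adj v u, ∃ e, G.IsLink e v u :=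
    fun u hu => (mem_filter.1 hu).2.2
  rcases isEmpty_or_nonempty E with hE | hE
  · rw [filter_false_of_mem fun u hu hvu => (hex u (mem_filter.2 ⟨hu, hvu⟩)).elim
      fun e _ => hE.elim e]
    exact Nat.zero_le _
  choose! e he using hex
  have hle : ((U.filter fun u => G.adjGraph.Adj v u : Finset V) : Set V).encard ≤
      (G.incidenceSet v).encard := by
    refine Set.encard_le_encard_of_injOn (f := e) (fun u hu => ⟨u, he u hu⟩) ?_
    intro a ha b hb hab
    have h1 := he a ha
    rw [hab] at h1
    exact h1.right_unique (he b hb)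
  rw [Set.encard_coe_eq_coe_finsetCard] at hle
  have := hle.trans (le_self_add.trans h)
  exact_mod_cast this

end Graph

theorem theorem4 :
    ∃ α : ℝ, 0 < α ∧ α ≤ 1 ∧
      ∀ (V : Type*) (E : Type*) (G : Graph V E) (Δ : ℕ),
        G.vertexSet.Finite → G.Loopless → 1 ≤ Δ →
        (∀ v ∈ G.vertexSet, G.eDegree v ≤ Δ) →
        ∃ A B : Set V,
          A ∪ B = G.vertexSet ∧ Disjoint A B ∧
          (G.vertexSet.Nontrivial → A.Nonempty ∧ B.Nonempty) ∧
          ⌊α * (G.treewidth : ℝ) / (Δ : ℝ) ^ 2⌋₊ ≤ (G.induce A).treewidth ∧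
          ⌊α * (G.treewidth : ℝ) / (Δ : ℝ) ^ 2⌋₊ ≤ (G.induce B).treewidth := by
  classical
  refine ⟨1 / 500, by norm_num, by norm_num, ?_⟩
  intro V E G Δ hfin _ hΔ hdeg
  generalize hr : ⌊1 / 500 * (G.treewidth : ℝ) / (Δ : ℝ) ^ 2⌋₊ = r
  -- For a zero bound any partition with nonempty sides will do; otherwise treewidth above `t` is
  -- exactly the bound `t + 1`.
  obtain _ | t := r
  · by_cases hnt : G.vertexSet.Nontrivial
    · obtain ⟨a, ha, b, hb, hab⟩ := hnt
      exact ⟨{a}, G.vertexSet \ {a}, by simpa using ha, Set.disjoint_sdiff_right,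
        fun _ => ⟨⟨a, rfl⟩, ⟨b, hb, hab.symm⟩⟩, Nat.zero_le _, Nat.zero_le _⟩
    · exact ⟨G.vertexSet, ∅, by simp, by simp, fun h => (hnt h).elim, Nat.zero_le _, Nat.zero_le _⟩
  · obtain ⟨U, hU⟩ : ∃ U : Finset V, (U : Set V) = G.vertexSet := hfin.exists_finset_coe
    have hG : ∀ k, G.adjGraph.TreewidthLE U k ↔ G.treewidth ≤ k := by
      intro k
      rw [Graph.treewidthLE_adjGraph_iff_treewidth_le, hU, G.induce_vertexSet]
    have hk : 500 * ((t + 1) * Δ ^ 2) ≤ G.treewidth := by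
      have h := Nat.floor_le (a := 1 / 500 * (G.treewidth : ℝ) / (Δ : ℝ) ^ 2) (by positivity)
      have hpos : (0 : ℝ) < (Δ : ℝ) ^ 2 := by positivity
      rw [hr, le_div_iff₀ hpos] at h
      have h' : (500 * ((t + 1) * Δ ^ 2) : ℝ) ≤ G.treewidth := by
        push_cast at h
        linarith
      exact_mod_cast h'
    obtain ⟨A, hAU, hA, hB⟩ := SimpleGraph.exists_partition_not_treewidthLE
      (H := G.adjGraph) (U := U) (t := t) hΔ
      (fun v hv => Graph.cross_adjGraph_le (hdeg v (hU ▸ hv)))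
      (fun k h => hk.trans ((hG k).1 h))
    have hne : ∀ X : Finset V, ¬ G.adjGraph.TreewidthLE X t → (X : Set V).Nonempty := by
      intro X hX
      rw [Finset.coe_nonempty, Finset.nonempty_iff_ne_empty]
      rintro rfl
      exact hX (SimpleGraph.treewidthLE_empty _ _)
    refine ⟨A, ((U \ A : Finset V) : Set V), ?_, ?_, fun _ => ⟨hne A hA, hne _ hB⟩, ?_, ?_⟩
    · rw [← Finset.coe_union, Finset.union_sdiff_of_subset hAU, hU]
    · exact Finset.disjoint_coe.2 Finset.disjoint_sdiff
    · rw [Graph.treewidthLE_adjGraph_iff_treewidth_le] at hA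
      omega
    · rw [Graph.treewidthLE_adjGraph_iff_treewidth_le] at hB
      omega
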